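/- \textbf{Setting.} Let $\mathsf X$ be a countably infinite set of variables. The terms of $\Lambda_\oplus$, taken up to renaming of bound variables, are $$M,N ::= x \mid \lambda x.M \mid M\,N \mid M\oplus N .$$ For a finite $\overline x\subseteq\mathsf X$, let $\Lambda_\oplus(\overline x)$ be the set of terms whose free variables lie in $\overline x$; closed terms are the elements of $\Lambda_\oplus(\emptyset)$, and values are closed abstractions. \textbf{Call-by-name semantics.} The approximation judgments $M\Downarrow\mathscr D$, with $\mathscr D$ a finitely supported subprobability distribution on values, are generated by the rules: $M\Downarrow\emptyset$; $V\Downarrow\{V\}$ for a value $V$; if $M\Downarrow\mathscr D$ and $P\{N/x\}\Downarrow\mathscr E_{P}$ for every $\lambda x.P$ in the support of $\mathscr D$, then $M\,N\Downarrow\sum_{\lambda x.P}\mathscr D(\lambda x.P)\cdot\mathscr E_{P}$; if $M\Downarrow\mathscr D$ and $N\Downarrow\mathscr E$, then $M\oplus N\Downarrow\frac12\mathscr D+\frac12\mathscr E$. The semantics of a closed term $M$ is the pointwise supremum $[\![M]\!]=\sup_{M\Downarrow\mathscr D}\mathscr D$, and the convergence probability of $M$ is $\sum_V[\![M]\!](V)$,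 the sum being over all values. \textbf{Applicative bisimilarity.} Consider the labelled Markov chain whose states are the closed terms together with a disjoint copy of the values (the distinguished values $\nu x.N$), whose labels are $\tau$ and the closed terms, and whose transition probabilities are $\mathcal P(M,\tau,\nu x.N)=[\![M]\!](\lambda x.N)$, $\mathcal P(\nu x.N,L,N\{L/x\})=1$, and $0$ in all other cases. A probabilistic applicative bisimulation is an equivalence relation $\mathcal R$ on states, relating only closed terms to closed terms and distinguished values to distinguished values, such that $s\,\mathcal R\,t$ implies $\sum_{u\in E}\mathcal P(s,\ell,u)=\sum_{u\in E}\mathcal P(t,\ell,u)$ for every label $\ell$ and every equivalence class $E$ of $\mathcal R$. Probabilistic applicative bisimilarity $\sim$ is the union of all such relations. For $M,N\in\Lambda_\oplus(\overline x)$, write $\overline x\vdash M\sim N$ if $M\sigma\sim N\sigma$ for every substitution $\sigma$ of closed terms for the variables. \textbf{Context equivalence.} Contexts with exactly one hole are generated by $C::=[\cdot]\mid\lambda x.C\mid C\,M\mid M\,C\mid C\oplus M\mid M\oplus C$, and $C[M]$ is the term obtained by filling the hole with $M$, where binders of $C$ may capture free variables of $M$. The sets $\mathsf C(\overline x;\overline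 y)$ of contexts are defined inductively: $[\cdot]\in\mathsf C(\overline x;\overline x)$; $\lambda x.C\in\mathsf C(\overline x;\overline y)$ if $x\notin\overline y$ and $C\in\mathsf C(\overline x;\overline y\cup\{x\})$; and $C\,M,\ M\,C,\ C\oplus M,\ M\oplus C\in\mathsf C(\overline x;\overline y)$ if $C\in\mathsf C(\overline x;\overline y)$ and $M\in\Lambda_\oplus(\overline y)$. For $M,N\in\Lambda_\oplus(\overline x)$, write $\overline x\vdash M\leq_\oplus N$ if for every $C\in\mathsf C(\overline x;\emptyset)$ the convergence probability of $C[M]$ is at most that of $C[N]$, and $\overline x\vdash M\simeq_\oplus N$ (probabilistic context equivalence) if $\overline x\vdash M\leq_\oplus N$ and $\overline x\vdash N\leq_\oplus M$. \textbf{Theorem.} For every finite $\overline x\subseteq\mathsf X$ and all $M,N\in\Lambda_\oplus(\overline x)$, if $\overline x\vdash M\sim N$ then $\overline x\vdash M\simeq_\oplus N$. -/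

import Mathlib

open scoped ENNReal

noncomputable section

namespace LambdaOplus

/-! ## Terms

The set of variable names is `ℕ`. Terms modulo renaming of bound variables are represented by
de Bruijn terms: under `k` binders the index `i < k` is bound, and the index `i + k` is the free
variable named `i`. Distinct de Bruijn terms are distinct α-equivalence classes. -/

/-- Term expressions of the probabilistic λ-calculus. -/
inductive Term : Type
  | var (i : ℕ) : Term
  | lam (P : Term) : Term
  | app (M N : Term) : Term
  | choice (M N : Term) : Term
  deriving Countable

namespace Term

/-- The set of free variables. -/
def FV : Term → Set ℕ
  | var i => {i}
  | lam P => {i | i + 1 ∈ FV P}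
  | app M N => FV M ∪ FV N
  | choice M N => FV M ∪ FV N

/-- Lift a renaming under a binder. -/
def liftRen (ρ : ℕ → ℕ) : ℕ → ℕ
  | 0 => 0
  | i + 1 => ρ i + 1

/-- Capture-avoiding renaming of the free variables. -/
def rename : Term → (ℕ → ℕ) → Term
  | var i, ρ => var (ρ i)
  | lam P, ρ => lam (P.rename (liftRen ρ))
  | app M N, ρ => app (M.rename ρ) (N.rename ρ)
  | choice M N, ρ => choice (M.rename ρ) (N.rename ρ)

/-- Lift a substitution under a binder. -/
def liftSub (σ : ℕ → Term) : ℕ → Term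
  | 0 => var 0
  | i + 1 => (σ i).rename Nat.succ

/-- Capture-avoiding simultaneous substitution for the free variables. -/
def subst : Term → (ℕ → Term) → Term
  | var i, σ => σ i
  | lam P, σ => lam (P.subst (liftSub σ))
  | app M N, σ => app (M.subst σ) (N.subst σ)
  | choice M N, σ => choice (M.subst σ) (N.subst σ)

/-- The capture-avoiding substitution `M{N/x}` of `N` for the free variable named `x`. -/
def subst1 (M : Term) (x : ℕ) (N : Term) : Term :=
  M.subst (fun y => if y = x then N else var y)

/-- The abstraction `λx.M` of the free variable named `x` in `M`. -/
def abs (x : ℕ) (M : Term) : Term :=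
  lam (M.rename (fun y => if y = x then 0 else y + 1))

/-- The result of replacing the variable bound by the outermost binder of `lam P` by `N`. -/
def inst (P N : Term) : Term :=
  P.subst (fun i => Nat.casesOn i N var)

theorem mem_FV_rename (M : Term) : ∀ (ρ : ℕ → ℕ) (i : ℕ),
    i ∈ (M.rename ρ).FV ↔ ∃ j ∈ M.FV, ρ j = i := by
  induction M with
  | var j => intro ρ i; simp [rename, FV, eq_comm]
  | lam P ih =>
    intro ρ i
    simp only [rename, FV, Set.mem_ofPred_eq, ih]
    constructor
    · rintro ⟨j, hj, h⟩
      cases j with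
      | zero => simp [liftRen] at h
      | succ j => exact ⟨j, hj, by simpa [liftRen] using h⟩
    · rintro ⟨j, hj, h⟩
      exact ⟨j + 1, hj, by simpa [liftRen] using h⟩
  | app M N ihM ihN =>
    intro ρ i; simp only [rename, FV, Set.mem_union, ihM, ihN]; grind
  | choice M N ihM ihN =>
    intro ρ i; simp only [rename, FV, Set.mem_union, ihM, ihN]; grind

theorem mem_FV_subst (M : Term) : ∀ (σ : ℕ → Term) (i : ℕ),
    i ∈ (M.subst σ).FV → ∃ j ∈ M.FV, i ∈ (σ j).FV := by
  induction M with
  | var j => intro σ i h; exact ⟨j, rfl, h⟩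
  | lam P ih =>
    intro σ i h
    obtain ⟨j, hj, h⟩ := ih _ _ h
    cases j with
    | zero => simp [liftSub, FV] at h
    | succ j =>
      obtain ⟨k, hk, e⟩ := (mem_FV_rename _ _ _).1 h
      obtain rfl : k = i := by simpa using e
      exact ⟨j, hj, hk⟩
  | app M N ihM ihN =>
    rintro σ i (h | h)
    · obtain ⟨j, hj, h⟩ := ihM _ _ h; exact ⟨j, Or.inl hj, h⟩
    · obtain ⟨j, hj, h⟩ := ihN _ _ h; exact ⟨j, Or.inr hj, h⟩
  | choice M N ihM ihN =>
    rintro σ i (h | h)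
    · obtain ⟨j, hj, h⟩ := ihM _ _ h; exact ⟨j, Or.inl hj, h⟩
    · obtain ⟨j, hj, h⟩ := ihN _ _ h; exact ⟨j, Or.inr hj, h⟩

/-- Free variables of `λx.M`. -/
theorem FV_abs (x : ℕ) (M : Term) : (abs x M).FV = M.FV \ {x} := by
  ext i
  simp only [abs, FV, Set.mem_ofPred_eq, mem_FV_rename, Set.mem_sdiff, Set.mem_singleton_iff]
  constructor
  · rintro ⟨j, hj, h⟩
    split_ifs at h with e
    obtain rfl : j = i := by omega
    exact ⟨hj, e⟩
  · rintro ⟨hi, e⟩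
    exact ⟨i, hi, by simp [e]⟩

theorem subst_rename (M : Term) : ∀ (ρ : ℕ → ℕ) (σ : ℕ → Term),
    (M.rename ρ).subst σ = M.subst (fun i => σ (ρ i)) := by
  induction M with
  | var j => intro ρ σ; rfl
  | lam P ih =>
    intro ρ σ
    simp only [rename, subst, ih]
    congr 2
    funext i
    cases i <;> rfl
  | app M N ihM ihN => intro ρ σ; simp only [rename, subst, ihM, ihN]
  | choice M N ihM ihN => intro ρ σ; simp only [rename, subst, ihM, ihN]

/-- Instantiating the bound variable of `λx.M` by `N` yields `M{N/x}`. -/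
theorem inst_abs (x : ℕ) (M N : Term) :
    inst (M.rename (fun y => if y = x then 0 else y + 1)) N = M.subst1 x N := by
  rw [inst, subst_rename, subst1]
  congr 1
  funext y
  by_cases h : y = x <;> simp [h]

end Term

/-- The terms whose free variables are among the finite set `X`. -/
def TermOver (X : Finset ℕ) : Type := {M : Term // M.FV ⊆ (X : Set ℕ)}

/-- Closed terms. -/
abbrev ClosedTerm : Type := TermOver ∅

/-- Apply a closing substitution, which maps every variable to a closed term. -/
def TermOver.close {X : Finset ℕ} (M : TermOver X) (σ : ℕ → ClosedTerm) : ClosedTerm :=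
  ⟨M.1.subst (fun i => (σ i).1), by
    intro i hi
    obtain ⟨j, -, h⟩ := Term.mem_FV_subst _ _ _ hi
    exact (σ j).2 h⟩

/-- A value is a closed abstraction `lam body`. -/
@[ext]
structure Value : Type where
  body : Term
  closed : (Term.lam body).FV = ∅

/-- A value, seen as a term. -/
def Value.toTerm (V : Value) : Term := Term.lam V.body

/-- For a value `λx.N` and a closed term `L`, the closed term `N{L/x}`. -/
def Value.apply (V : Value) (L : ClosedTerm) : ClosedTerm :=
  ⟨V.body.inst L.1, by
    intro i hi
    obtain ⟨j, hj, h⟩ := Term.mem_FV_subst _ _ _ hi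
    cases j with
    | zero => exact L.2 h
    | succ j =>
      have : j ∈ (Term.lam V.body).FV := hj
      simp [V.closed] at this⟩

instance (X : Finset ℕ) : Countable (TermOver X) :=
  inferInstanceAs (Countable {M : Term // M.FV ⊆ (X : Set ℕ)})

instance : Countable Value :=
  Function.Injective.countable (f := Value.body) (fun _ _ h => Value.ext h)

/-! ## Call-by-name semantics -/

open Classical in
/-- Big-step approximation semantics. In the rule for application, only the values in the
support of `D` contribute to the sum, and a premise is required for exactly these values.
All the distributions that are derived have finite support. -/
inductive BigStep : Term → (Value → ℝ≥0∞) → Prop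
  | bt (M : Term) : BigStep M 0
  | bv (V : Value) : BigStep V.toTerm (Pi.single V 1)
  | ba {M N : Term} {D : Value → ℝ≥0∞} {E : Value → Value → ℝ≥0∞} :
      BigStep M D → (∀ V, D V ≠ 0 → BigStep (V.body.inst N) (E V)) →
      BigStep (Term.app M N) (fun W => ∑' V, D V * E V W)
  | bs {M N : Term} {D E : Value → ℝ≥0∞} :
      BigStep M D → BigStep N E →
      BigStep (Term.choice M N) (fun W => 2⁻¹ * D W + 2⁻¹ * E W)

/-- The semantics of a (closed) term: the pointwise supremum of its finite approximations. -/
def sem (M : Term) : Value → ℝ≥0∞ := sSup {D | BigStep M D}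

/-- `M` converges with probability `p`: the semantics of `M` has total mass `p`. -/
def ConvergesWith (M : Term) (p : ℝ≥0∞) : Prop := ∑' V, sem M V = p

theorem BigStep.tsum_le_one {M : Term} {D : Value → ℝ≥0∞} (h : BigStep M D) :
    ∑' V, D V ≤ 1 := by
  induction h with
  | bt M => simp
  | bv V => simp [tsum_pi_single]
  | @ba M N D E _ _ ihD ihE =>
    rw [ENNReal.tsum_comm]
    refine le_trans (ENNReal.tsum_le_tsum fun V => ?_) ihD
    rw [ENNReal.tsum_mul_left]
    by_cases hV : D V = 0
    · simp [hV]
    · exact mul_le_of_le_one_right' (ihE V hV)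
  | bs _ _ ihD ihE =>
    rw [ENNReal.tsum_add, ENNReal.tsum_mul_left, ENNReal.tsum_mul_left]
    calc _ ≤ (2⁻¹ : ℝ≥0∞) * 1 + 2⁻¹ * 1 := by gcongr
      _ = 1 := by simp [ENNReal.inv_two_add_inv_two]

theorem BigStep.directed {M : Term} {D : Value → ℝ≥0∞} (h : BigStep M D) :
    ∀ {D' : Value → ℝ≥0∞}, BigStep M D' → ∃ F, BigStep M F ∧ D ≤ F ∧ D' ≤ F := by
  induction h with
  | bt M => intro D' h'; exact ⟨D', h', fun _ => zero_le, le_rfl⟩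
  | bv V =>
    intro D' h'
    generalize hT : V.toTerm = T at h'
    cases h' with
    | bt M => subst hT; exact ⟨_, .bv V, le_rfl, fun _ => zero_le⟩
    | bv V' =>
      obtain rfl : V = V' := Value.ext (by simpa [Value.toTerm] using hT)
      exact ⟨_, .bv V, le_rfl, le_rfl⟩
    | ba _ _ => simp [Value.toTerm] at hT
    | bs _ _ => simp [Value.toTerm] at hT
  | @ba M N D E hD hE ihD ihE =>
    intro D' h'
    cases h' with
    | bt M => exact ⟨_, .ba hD hE, le_rfl, fun _ => zero_le⟩
    | @ba _ _ D₂ E₂ hD₂ hE₂ =>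
      obtain ⟨F, hF, h1, h2⟩ := ihD hD₂
      have key : ∀ V, ∃ G, BigStep (V.body.inst N) G ∧
          (D V ≠ 0 → E V ≤ G) ∧ (D₂ V ≠ 0 → E₂ V ≤ G) := by
        intro V
        by_cases a : D V = 0
        · by_cases b : D₂ V = 0
          · exact ⟨0, .bt _, fun c => absurd a c, fun c => absurd b c⟩
          · exact ⟨E₂ V, hE₂ V b, fun c => absurd a c, fun _ => le_rfl⟩
        · by_cases b : D₂ V = 0
          · exact ⟨E V, hE V a, fun _ => le_rfl, fun c => absurd b c⟩
          · obtain ⟨G, hG, g1, g2⟩ := ihE V a (hE₂ V b)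
            exact ⟨G, hG, fun _ => g1, fun _ => g2⟩
      choose G hG g1 g2 using key
      refine ⟨_, .ba hF (fun V _ => hG V), fun W => ENNReal.tsum_le_tsum fun V => ?_,
        fun W => ENNReal.tsum_le_tsum fun V => ?_⟩
      · by_cases a : D V = 0
        · simp [a]
        · exact mul_le_mul' (h1 V) (g1 V a W)
      · by_cases a : D₂ V = 0
        · simp [a]
        · exact mul_le_mul' (h2 V) (g2 V a W)
  | @bs M N D E hD hE ihD ihE =>
    intro D' h'
    cases h' with
    | bt M => exact ⟨_, .bs hD hE, le_rfl, fun _ => zero_le⟩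
    | bs hD₂ hE₂ =>
      obtain ⟨F, hF, f1, f2⟩ := ihD hD₂
      obtain ⟨G, hG, g1, g2⟩ := ihE hE₂
      refine ⟨_, .bs hF hG, fun W => ?_, fun W => ?_⟩
      · exact add_le_add (mul_le_mul' le_rfl (f1 W)) (mul_le_mul' le_rfl (g1 W))
      · exact add_le_add (mul_le_mul' le_rfl (f2 W)) (mul_le_mul' le_rfl (g2 W))

theorem tsum_sem_le_one (M : Term) : ∑' V, sem M V ≤ 1 := by
  rw [ENNReal.tsum_eq_iSup_sum]
  refine iSup_le fun s => ?_
  have h : ∀ V, sem M V = ⨆ D : {D // BigStep M D}, D.1 V := fun V => by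
    rw [sem, sSup_apply]; rfl
  simp only [h]
  rw [ENNReal.finsetSum_iSup (fun D D' => ?_)]
  · exact iSup_le fun D => (ENNReal.sum_le_tsum s).trans D.2.tsum_le_one
  · obtain ⟨F, hF, h1, h2⟩ := D.2.directed D'.2
    exact ⟨⟨F, hF⟩, fun V => ⟨h1 V, h2 V⟩⟩

/-! ## Labelled Markov chains and probabilistic bisimilarity -/

/-- A labelled Markov chain with a countable set `S` of states and a set `L` of labels. -/
structure LabelledMarkovChain (S L : Type) [Countable S] where
  prob : S → L → S → ℝ≥0∞
  tsum_prob_le_one : ∀ ℓ s, ∑' t, prob s ℓ t ≤ 1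

/-- The probability of moving from `s` with label `ℓ` to a state in `A`. -/
def LabelledMarkovChain.probSet {S L : Type} [Countable S] (C : LabelledMarkovChain S L)
    (s : S) (ℓ : L) (A : Set S) : ℝ≥0∞ := ∑' t : A, C.prob s ℓ t

/-- An equivalence relation is a probabilistic bisimulation if related states have, for every
label, the same probability of reaching each equivalence class. -/
def LabelledMarkovChain.IsBisimulation {S L : Type} [Countable S] (C : LabelledMarkovChain S L)
    (R : Setoid S) : Prop :=
  ∀ s t, R s t → ∀ ℓ, ∀ E ∈ R.classes, C.probSet s ℓ E = C.probSet t ℓ E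

/-- States: closed terms, and a disjoint copy of the values (the distinguished values). -/
abbrev State : Type := ClosedTerm ⊕ Value

/-- Labels: closed terms (parameter passing), and `τ = Sum.inr ()` (evaluation). -/
abbrev Label : Type := ClosedTerm ⊕ Unit

open Classical in
/-- The transition probability matrix: a closed term evaluates under `τ` to a distinguished value
according to its semantics, and a distinguished value `λx.N` moves with probability `1`
under the label `L` to `N{L/x}`. -/
def trans : State → Label → State → ℝ≥0∞
  | Sum.inl M, Sum.inr _, Sum.inr V => sem M.1 V
  | Sum.inr V, Sum.inl L, Sum.inl P => if P = V.apply L then 1 else 0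
  | _, _, _ => 0

theorem tsum_trans_le_one (ℓ : Label) (s : State) : ∑' t, trans s ℓ t ≤ 1 := by
  rw [Summable.tsum_sum ENNReal.summable ENNReal.summable]
  rcases s with M | V <;> rcases ℓ with L | u
  · simp [trans]
  · simpa [trans] using tsum_sem_le_one M.1
  · simp [trans, tsum_ite_eq]
  · simp [trans]

/-- The calculus as a multisorted labelled Markov chain. -/
def chain : LabelledMarkovChain State Label where
  prob := trans
  tsum_prob_le_one := tsum_trans_le_one

/-- A probabilistic applicative bisimulation: a probabilistic bisimulation on the multisorted
chain, hence one that relates only states of the same sort. -/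
def IsPAB (R : Setoid State) : Prop :=
  chain.IsBisimulation R ∧ ∀ s t, R s t → s.isLeft = t.isLeft

/-- Probabilistic applicative bisimilarity: the union of all such bisimulations. -/
def Bisimilar (s t : State) : Prop := ∃ R : Setoid State, IsPAB R ∧ R s t

/-- Probabilistic applicative bisimilarity on terms with free variables in `X`: bisimilarity of
the closed terms obtained from every closing substitution. -/
def OpenBisimilar (X : Finset ℕ) (M N : TermOver X) : Prop :=
  ∀ σ : ℕ → ClosedTerm, Bisimilar (Sum.inl (M.close σ)) (Sum.inl (N.close σ))

/-! ## Contexts and context equivalence -/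

/-- Term contexts with exactly one hole. Binders carry names, since they may capture. -/
inductive Ctx : Type
  | hole : Ctx
  | lam (x : ℕ) (C : Ctx) : Ctx
  | appL (C : Ctx) (M : Term) : Ctx
  | appR (M : Term) (C : Ctx) : Ctx
  | choiceL (C : Ctx) (M : Term) : Ctx
  | choiceR (M : Term) (C : Ctx) : Ctx

/-- Fill the hole, possibly capturing free variables. -/
def Ctx.fill : Ctx → Term → Term
  | .hole, N => N
  | .lam x C, N => Term.abs x (C.fill N)
  | .appL C M, N => Term.app (C.fill N) M
  | .appR M C, N => Term.app M (C.fill N)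
  | .choiceL C M, N => Term.choice (C.fill N) M
  | .choiceR M C, N => Term.choice M (C.fill N)

/-- `CtxOver C X Y`: the context `C` turns terms with free variables in `X` into terms with free
variables in `Y`. -/
inductive CtxOver : Ctx → Finset ℕ → Finset ℕ → Prop
  | hole (X : Finset ℕ) : CtxOver .hole X X
  | lam {C : Ctx} {X Y : Finset ℕ} {x : ℕ} :
      CtxOver C X (Y ∪ {x}) → x ∉ Y → CtxOver (.lam x C) X Y
  | appL {C : Ctx} {X Y : Finset ℕ} (M : TermOver Y) :
      CtxOver C X Y → CtxOver (.appL C M.1) X Y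
  | appR {C : Ctx} {X Y : Finset ℕ} (M : TermOver Y) :
      CtxOver C X Y → CtxOver (.appR M.1 C) X Y
  | choiceL {C : Ctx} {X Y : Finset ℕ} (M : TermOver Y) :
      CtxOver C X Y → CtxOver (.choiceL C M.1) X Y
  | choiceR {C : Ctx} {X Y : Finset ℕ} (M : TermOver Y) :
      CtxOver C X Y → CtxOver (.choiceR M.1 C) X Y

/-- The probabilistic context preorder. -/
def CtxPreorder (X : Finset ℕ) (M N : TermOver X) : Prop :=
  ∀ C : Ctx, CtxOver C X ∅ → ∀ p, ConvergesWith (C.fill M.1) p →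
    ∃ q, ConvergesWith (C.fill N.1) q ∧ p ≤ q

/-- Probabilistic context equivalence. -/
def CtxEquiv (X : Finset ℕ) (M N : TermOver X) : Prop :=
  CtxPreorder X M N ∧ CtxPreorder X N M

end LambdaOplus

end

/-!
The proof is Howe's method. A bisimulation gives related states the same probability of entering
any union of classes, so bisimilar closed terms are similar: for every set `A` of values, the second
term reaches the values above `A` with at least the probability with which the first reaches `A`.
It then suffices that open similarity is preserved by contexts. Its Howe closure is preserved by
contexts by construction, and an induction on big-step derivations shows that this closure is itself
a simulation, which with `A` the set of all values gives the inequality of convergence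
probabilities. The delicate case of the induction is application, where domination of the
distributions on the operators has to be turned into domination of the mixtures they define: by
the layer-cake formula, both are averages over `t` of the masses of superlevel sets, which are
compared one `t` at a time. This replaces the disentangling of sets of values by
a max-flow min-cut argument.
-/

open scoped Function

namespace LambdaOplus

/-! ## Domination along a relation -/

section RelLift

variable {α β γ δ : Type*}

/-- The mass that the distribution `D` gives to the set `A`. -/
noncomputable def mass (D : α → ℝ≥0∞) (A : Set α) : ℝ≥0∞ := ∑' x : A, D x

theorem mass_univ (D : α → ℝ≥0∞) : mass D Set.univ = ∑' x, D x :=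
  tsum_univ D

theorem mass_mono_left {D E : α → ℝ≥0∞} (h : D ≤ E) (A : Set α) : mass D A ≤ mass E A :=
  ENNReal.tsum_le_tsum fun x => h x

theorem mass_mono_right (D : α → ℝ≥0∞) {A B : Set α} (h : A ⊆ B) : mass D A ≤ mass D B :=
  ENNReal.tsum_mono_subtype D h

theorem le_mass (D : α → ℝ≥0∞) {A : Set α} {x : α} (hx : x ∈ A) : D x ≤ mass D A :=
  ENNReal.le_tsum (⟨x, hx⟩ : A)

theorem mass_single [DecidableEq α] (x : α) (c : ℝ≥0∞) (A : Set α) :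
    mass (Pi.single x c) A = A.indicator (fun _ => c) x := by
  rw [mass, tsum_subtype, tsum_eq_single x fun y hy => by simp [Set.indicator, hy]]
  simp [Set.indicator]

theorem mass_inter_support (D : α → ℝ≥0∞) (A : Set α) :
    mass D (A ∩ Function.support D) = mass D A := by
  simp only [mass, tsum_subtype, Set.indicator_inter_support]

theorem mass_add (D E : α → ℝ≥0∞) (A : Set α) : mass (D + E) A = mass D A + mass E A :=
  ENNReal.tsum_add

theorem mass_smul (c : ℝ≥0∞) (D : α → ℝ≥0∞) (A : Set α) : mass (c • D) A = c * mass D A :=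
  ENNReal.tsum_mul_left

theorem mass_tsum_mul (D : α → ℝ≥0∞) (F : α → β → ℝ≥0∞) (A : Set β) :
    mass (fun y => ∑' x, D x * F x y) A = ∑' x, D x * mass (F x) A := by
  simp only [mass, ← ENNReal.tsum_mul_left]
  exact ENNReal.tsum_comm

theorem tsum_iSup_of_directed {ι : Type*} {f : ι → α → ℝ≥0∞} (hf : Directed (· ≤ ·) f) :
    ∑' a, ⨆ i, f i a = ⨆ i, ∑' a, f i a := by
  simp only [ENNReal.tsum_eq_iSup_sum]
  rw [iSup_comm]
  refine iSup_congr fun s => ENNReal.finsetSum_iSup fun i j => ?_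
  obtain ⟨k, hik, hjk⟩ := hf i j
  exact ⟨k, fun a => ⟨hik a, hjk a⟩⟩

open MeasureTheory in
theorem setLIntegral_Ici_indicator_ofReal_lt (a c : ℝ≥0∞) :
    ∫⁻ t in Set.Ici (0 : ℝ), {t | ENNReal.ofReal t < a}.indicator (fun _ => c) t = c * a := by
  have hmeas : MeasurableSet {t | ENNReal.ofReal t < a} :=
    ENNReal.measurable_ofReal measurableSet_Iio
  rw [lintegral_indicator_const hmeas, Measure.restrict_apply hmeas]
  congr 1
  induction a with
  | top => simp
  | coe a =>
    have hIco : {t | ENNReal.ofReal t < a} ∩ Set.Ici 0 = Set.Ico 0 (a : ℝ) := by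
      ext t
      simp +contextual [and_comm, ENNReal.ofReal_lt_coe_iff]
    simp [hIco]

open MeasureTheory in
theorem tsum_mul_eq_lintegral_mass [Countable α] (D f : α → ℝ≥0∞) :
    ∑' x, D x * f x = ∫⁻ t in Set.Ici (0 : ℝ), mass D {x | ENNReal.ofReal t < f x} := by
  simp only [mass, tsum_subtype, ← setLIntegral_Ici_indicator_ofReal_lt]
  refine (lintegral_tsum fun x => Measurable.aemeasurable ?_).symm
  exact measurable_const.indicator (ENNReal.measurable_ofReal measurableSet_Iio)

/-- Lifting of a relation to distributions: `E` dominates `D` along `R`. The comparison of masses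
stands for the existence of a coupling of `D` and `E` carried by `R`. -/
def RelLift (R : α → β → Prop) (D : α → ℝ≥0∞) (E : β → ℝ≥0∞) : Prop :=
  ∀ A : Set α, mass D A ≤ mass E {y | ∃ x ∈ A, R x y}

namespace RelLift

variable {R : α → β → Prop} {D D' : α → ℝ≥0∞} {E E' : β → ℝ≥0∞}

theorem refl {R : α → α → Prop} [Std.Refl R] (D : α → ℝ≥0∞) : RelLift R D D :=
  fun _ => mass_mono_right D fun x hx => ⟨x, hx, Std.Refl.refl x⟩

theorem comp {S : β → γ → Prop} {F : γ → ℝ≥0∞} (h : RelLift R D E) (h' : RelLift S E F) :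
    RelLift (Relation.Comp R S) D F := by
  refine fun A => (h A).trans ((h' _).trans (mass_mono_right F ?_))
  rintro z ⟨y, ⟨x, hx, hxy⟩, hyz⟩
  exact ⟨x, hx, y, hxy, hyz⟩

theorem mono {S : α → β → Prop} (hRS : ∀ x y, R x y → S x y) (h : RelLift R D E) :
    RelLift S D E :=
  fun A => (h A).trans (mass_mono_right E fun y ⟨x, hx, hxy⟩ => ⟨x, hx, hRS x y hxy⟩)

theorem mono_right (h : RelLift R D E) (hE : E ≤ E') : RelLift R D E' :=
  fun A => (h A).trans (mass_mono_left hE _)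

theorem tsum_le (h : RelLift R D E) : ∑' x, D x ≤ ∑' y, E y := by
  rw [← mass_univ D, ← mass_univ E]
  exact (h Set.univ).trans (mass_mono_right E (Set.subset_univ _))

theorem restrict_support (h : RelLift R D E) : RelLift (fun x y => D x ≠ 0 ∧ R x y) D E := by
  intro A
  rw [← mass_inter_support]
  refine (h _).trans (mass_mono_right E ?_)
  rintro y ⟨x, ⟨hx, hDx⟩, hxy⟩
  exact ⟨x, hx, hDx, hxy⟩

theorem zero (R : α → β → Prop) (E : β → ℝ≥0∞) : RelLift R 0 E := by
  intro A
  simp [mass]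

theorem single [DecidableEq α] {x : α} {y : β} {c : ℝ≥0∞} (hxy : R x y) (hE : c ≤ E y) :
    RelLift R (Pi.single x c) E := by
  intro A
  rw [mass_single]
  by_cases hx : x ∈ A
  · rw [Set.indicator_of_mem hx]
    exact hE.trans (le_mass E ⟨x, hx, hxy⟩)
  · simp [hx]

theorem rel_of_single [DecidableEq α] [DecidableEq β] {x : α} {y : β} {c d : ℝ≥0∞}
    (hc : c ≠ 0) (h : RelLift R (Pi.single x c) (Pi.single y d)) : R x y := by
  by_contra hxy
  have := h {x}
  simp [mass_single, hxy, hc] at this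

theorem add (h : RelLift R D E) (h' : RelLift R D' E') : RelLift R (D + D') (E + E') := by
  intro A
  simp only [mass_add]
  exact add_le_add (h A) (h' A)

theorem smul (c : ℝ≥0∞) (h : RelLift R D E) : RelLift R (c • D) (c • E) := by
  intro A
  simp only [mass_smul]
  exact mul_le_mul_right (h A) c

theorem tsum_mul_le [Countable α] [Countable β] (h : RelLift R D E) {f : α → ℝ≥0∞}
    {g : β → ℝ≥0∞} (hfg : ∀ x y, R x y → f x ≤ g y) :
    ∑' x, D x * f x ≤ ∑' y, E y * g y := by
  rw [tsum_mul_eq_lintegral_mass, tsum_mul_eq_lintegral_mass]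
  refine MeasureTheory.lintegral_mono fun t => (h _).trans (mass_mono_right E ?_)
  rintro y ⟨x, hx, hxy⟩
  exact hx.trans_le (hfg x y hxy)

theorem bind [Countable α] [Countable β] {S : γ → δ → Prop} {F : α → γ → ℝ≥0∞}
    {G : β → δ → ℝ≥0∞} (h : RelLift R D E)
    (hFG : ∀ x y, D x ≠ 0 → R x y → RelLift S (F x) (G y)) :
    RelLift S (fun z => ∑' x, D x * F x z) (fun z => ∑' y, E y * G y z) := by
  intro A
  rw [mass_tsum_mul, mass_tsum_mul]
  exact h.restrict_support.tsum_mul_le fun x y hxy => hFG x y hxy.1 hxy.2 A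

end RelLift

end RelLift

/-! ## Substitution -/

namespace Term

theorem subst_congr {M : Term} {σ τ : ℕ → Term} (h : ∀ i ∈ M.FV, σ i = τ i) :
    M.subst σ = M.subst τ := by
  induction M generalizing σ τ with
  | var i => exact h i rfl
  | lam P ih =>
    refine congrArg lam (ih fun i hi => ?_)
    cases i with
    | zero => rfl
    | succ i => exact congrArg (rename · Nat.succ) (h i hi)
  | app M N ihM ihN | choice M N ihM ihN =>
    simp only [subst, ihM fun i hi => h i (Or.inl hi), ihN fun i hi => h i (Or.inr hi)]

theorem subst_var (M : Term) : M.subst var = M := by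
  have liftSub_var : liftSub var = var := by
    funext i
    cases i <;> rfl
  induction M with
  | var i => rfl
  | lam P ih => rw [subst, liftSub_var, ih]
  | app M N ihM ihN | choice M N ihM ihN => rw [subst, ihM, ihN]

theorem subst_of_FV_eq_empty {M : Term} (h : M.FV = ∅) (σ : ℕ → Term) : M.subst σ = M := by
  rw [subst_congr (τ := var) (by simp [h]), subst_var]

theorem rename_eq_subst (M : Term) (ρ : ℕ → ℕ) : M.rename ρ = M.subst (fun i => var (ρ i)) := by
  induction M generalizing ρ with
  | var i => rfl
  | lam P ih =>
    rw [rename, subst, ih]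
    congr 2
    funext i
    cases i <;> rfl
  | app M N ihM ihN | choice M N ihM ihN => rw [rename, subst, ihM, ihN]

theorem rename_rename (M : Term) (ρ ρ' : ℕ → ℕ) :
    (M.rename ρ).rename ρ' = M.rename (ρ' ∘ ρ) := by
  rw [rename_eq_subst _ ρ', subst_rename, rename_eq_subst]
  rfl

theorem rename_subst (M : Term) (σ : ℕ → Term) (ρ : ℕ → ℕ) :
    (M.subst σ).rename ρ = M.subst (fun i => (σ i).rename ρ) := by
  induction M generalizing σ ρ with
  | var i => rfl
  | lam P ih =>
    rw [subst, rename, ih, subst]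
    congr 2
    funext i
    cases i with
    | zero => rfl
    | succ i => simp only [liftSub, rename_rename]; rfl
  | app M N ihM ihN | choice M N ihM ihN => simp only [subst, rename, ihM, ihN]

theorem subst_subst (M : Term) (σ τ : ℕ → Term) :
    (M.subst σ).subst τ = M.subst (fun i => (σ i).subst τ) := by
  induction M generalizing σ τ with
  | var i => rfl
  | lam P ih =>
    simp only [subst, ih]
    congr 2
    funext i
    cases i with
    | zero => rfl
    | succ i => simp only [liftSub, subst_rename, rename_subst]
  | app M N ihM ihN | choice M N ihM ihN => simp only [subst, ihM, ihN]

/-- The closed instance of a term under a closing substitution; it extends `TermOver.close` to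
terms that carry no bound on their free variables. -/
def close (M : Term) (σ : ℕ → ClosedTerm) : ClosedTerm :=
  ⟨M.subst fun i => (σ i).1, fun _ hi =>
    let ⟨j, _, hj⟩ := mem_FV_subst _ _ _ hi
    (σ j).2 hj⟩

theorem close_subst (M : Term) (σ : ℕ → Term) (τ : ℕ → ClosedTerm) :
    (M.subst σ).close τ = M.close fun i => (σ i).close τ :=
  Subtype.ext (subst_subst M σ _)

end Term

theorem ClosedTerm.FV_eq_empty (M : ClosedTerm) : M.1.FV = ∅ :=
  Set.subset_empty_iff.1 (by simpa using M.2)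

theorem ClosedTerm.close_eq (M : ClosedTerm) (σ : ℕ → ClosedTerm) : M.1.close σ = M :=
  Subtype.ext (Term.subst_of_FV_eq_empty M.FV_eq_empty _)

instance : Inhabited ClosedTerm :=
  ⟨⟨.lam (.var 0), fun i hi => by simp [Term.FV] at hi⟩⟩

theorem Value.body_subst (V : Value) (σ : ℕ → Term) : V.body.subst σ = V.body.inst (σ 0) := by
  refine Term.subst_congr fun i hi => ?_
  cases i with
  | zero => rfl
  | succ i => exact absurd (show i ∈ (Term.lam V.body).FV from hi) (by simp [V.closed])

theorem CtxOver.FV_fill_subset {C : Ctx} {X Y : Finset ℕ} (h : CtxOver C X Y) {M : Term}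
    (hM : M.FV ⊆ (X : Set ℕ)) : (C.fill M).FV ⊆ (Y : Set ℕ) := by
  induction h with
  | hole => exact hM
  | lam _ _ ih =>
    rw [Ctx.fill, Term.FV_abs, Set.sdiff_subset_iff, Set.union_comm]
    simpa using ih hM
  | appL L _ ih | choiceL L _ ih => exact Set.union_subset (ih hM) L.2
  | appR L _ ih | choiceR L _ ih => exact Set.union_subset L.2 (ih hM)

/-! ## Structural inequalities for the semantics -/

theorem BigStep.le_sem {M : Term} {D : Value → ℝ≥0∞} (h : BigStep M D) : D ≤ sem M :=
  le_sSup (α := Value → ℝ≥0∞) h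

theorem sem_apply (M : Term) (V : Value) : sem M V = ⨆ D : {D // BigStep M D}, D.1 V := by
  rw [sem, sSup_apply]
  rfl

theorem directed_bigStep (M : Term) :
    Directed (· ≤ ·) (fun D : {D // BigStep M D} => D.1) := fun D D' =>
  let ⟨F, hF, hDF, hD'F⟩ := D.2.directed D'.2
  ⟨⟨F, hF⟩, hDF, hD'F⟩

instance (M : Term) : Nonempty {D // BigStep M D} := ⟨⟨0, .bt M⟩⟩

theorem mass_sem (M : Term) (A : Set Value) :
    mass (sem M) A = ⨆ D : {D // BigStep M D}, mass D.1 A := by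
  simp only [mass, sem_apply]
  exact tsum_iSup_of_directed fun D D' =>
    let ⟨F, hDF, hD'F⟩ := directed_bigStep M D D'
    ⟨F, fun V => hDF V, fun V => hD'F V⟩

theorem relLift_sem_left {β : Type*} {R : Value → β → Prop} {M : Term} {E : β → ℝ≥0∞}
    (h : ∀ D, BigStep M D → RelLift R D E) : RelLift R (sem M) E := by
  intro A
  rw [mass_sem]
  exact iSup_le fun D => h D.1 D.2 A

theorem one_le_sem_toTerm (V : Value) : 1 ≤ sem V.toTerm V := by
  classical
  simpa using BigStep.le_sem (.bv V) V

theorem average_sem_le_sem_choice (M N : Term) :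
    (2⁻¹ : ℝ≥0∞) • sem M + (2⁻¹ : ℝ≥0∞) • sem N ≤ sem (.choice M N) := by
  intro W
  simp only [Pi.add_apply, Pi.smul_apply, smul_eq_mul, sem_apply M, sem_apply N, ENNReal.mul_iSup]
  exact ENNReal.iSup_add_iSup_le fun D E => BigStep.le_sem (.bs D.2 E.2) W

theorem tsum_sem_mul_sem_inst_le_sem_app (M N : Term) :
    (fun W => ∑' V : Value, sem M V * sem (V.body.inst N) W) ≤ sem (.app M N) := by
  intro W
  let Approx := {D // BigStep M D} × (∀ V : Value, {E // BigStep (V.body.inst N) E})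
  have hterm : ∀ V : Value,
      sem M V * sem (V.body.inst N) W = ⨆ i : Approx, i.1.1 V * (i.2 V).1 W := by
    intro V
    rw [sem_apply M, sem_apply (V.body.inst N),
      ← (Function.surjective_eval (β := fun V : Value => {E // BigStep (V.body.inst N) E})
        V).iSup_comp, iSup_prod]
    simp only [Function.eval, ENNReal.iSup_mul]
    simp only [ENNReal.mul_iSup]
  have hdir : Directed (· ≤ ·) fun (i : Approx) (V : Value) => i.1.1 V * (i.2 V).1 W := by
    intro i j
    obtain ⟨F, hiF, hjF⟩ := directed_bigStep M i.1 j.1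
    choose G hiG hjG using fun V : Value => directed_bigStep (V.body.inst N) (i.2 V) (j.2 V)
    exact ⟨(F, G), fun V => mul_le_mul' (hiF V) (hiG V W), fun V => mul_le_mul' (hjF V) (hjG V W)⟩
  simp only [hterm]
  rw [tsum_iSup_of_directed hdir]
  exact iSup_le fun i => BigStep.le_sem (.ba i.1.2 fun V _ => (i.2 V).2) W

/-! ## Applicative similarity -/

/-- A probabilistic applicative simulation, given by its part on closed terms: distinguished values
are related when they stay related under every argument. -/
def IsSimulation (R : ClosedTerm → ClosedTerm → Prop) : Prop :=
  ∀ ⦃M N⦄, R M N → RelLift (fun V W : Value => ∀ L, R (V.apply L) (W.apply L)) (sem M.1) (sem N.1)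

/-- Probabilistic applicative similarity, the union of all simulations. -/
def Similar (M N : ClosedTerm) : Prop := ∃ R, IsSimulation R ∧ R M N

theorem isSimulation_eq : IsSimulation Eq := by
  rintro M _ rfl
  have : Std.Refl fun V W : Value => ∀ L, V.apply L = W.apply L := ⟨fun _ _ => rfl⟩
  exact .refl _

theorem IsSimulation.comp {R S : ClosedTerm → ClosedTerm → Prop} (hR : IsSimulation R)
    (hS : IsSimulation S) : IsSimulation (Relation.Comp R S) := by
  rintro M L ⟨N, hMN, hNL⟩
  refine ((hR hMN).comp (hS hNL)).mono ?_
  rintro V U ⟨W, hVW, hWU⟩ L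
  exact ⟨W.apply L, hVW L, hWU L⟩

theorem isSimulation_similar : IsSimulation Similar := by
  rintro M N ⟨R, hR, hMN⟩
  exact (hR hMN).mono fun V W hVW L => ⟨R, hR, hVW L⟩

theorem Similar.refl (M : ClosedTerm) : Similar M M := ⟨Eq, isSimulation_eq, rfl⟩

theorem Similar.trans {M N L : ClosedTerm} :
    Similar M N → Similar N L → Similar M L
  | ⟨_, hR, hMN⟩, ⟨_, hS, hNL⟩ => ⟨_, hR.comp hS, N, hMN, hNL⟩

theorem saturation_eq_biUnion_classes {S : Type*} (R : Setoid S) (A : Set S) :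
    {t | ∃ s ∈ A, R s t} = ⋃ E ∈ {E ∈ R.classes | (E ∩ A).Nonempty}, E := by
  ext t
  simp only [Set.mem_ofPred_eq, Set.mem_iUnion]
  constructor
  · rintro ⟨s, hs, hst⟩
    exact ⟨{x | R x s}, ⟨R.mem_classes s, s, R.refl s, hs⟩, R.symm hst⟩
  · rintro ⟨E, ⟨hE, s, hsE, hs⟩, htE⟩
    exact ⟨s, hs, R.rel_iff_exists_classes.2 ⟨E, hE, hsE, htE⟩⟩

section Bisimulation

variable {S L : Type} [Countable S] {C : LabelledMarkovChain S L} {R : Setoid S}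

theorem LabelledMarkovChain.IsBisimulation.relLift_prob (hR : C.IsBisimulation R) {s t : S}
    (h : R s t) (ℓ : L) : RelLift R (C.prob s ℓ) (C.prob t ℓ) := by
  intro A
  let classesMeeting : Set (Set S) := {E ∈ R.classes | (E ∩ A).Nonempty}
  have mass_saturation : ∀ D : S → ℝ≥0∞,
      mass D {t | ∃ s ∈ A, R s t} = ∑' E : classesMeeting, mass D E := by
    intro D
    rw [mass, saturation_eq_biUnion_classes]
    exact ENNReal.tsum_biUnion' fun E hE F hF =>
      R.isPartition_classes.pairwiseDisjoint hE.1 hF.1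
  calc mass (C.prob s ℓ) A
      ≤ mass (C.prob s ℓ) {t | ∃ s ∈ A, R s t} :=
        mass_mono_right _ fun u hu => ⟨u, hu, R.refl u⟩
    _ = ∑' E : classesMeeting, C.probSet s ℓ E := mass_saturation _
    _ = ∑' E : classesMeeting, C.probSet t ℓ E := tsum_congr fun E => hR s t h ℓ E E.2.1
    _ = mass (C.prob t ℓ) {t | ∃ s ∈ A, R s t} := (mass_saturation _).symm

end Bisimulation

theorem mass_chain_prob_term (M : ClosedTerm) (B : Set State) :
    mass (chain.prob (Sum.inl M) (Sum.inr ())) B = mass (sem M.1) (Sum.inr ⁻¹' B) := by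
  simp only [mass, tsum_subtype]
  rw [Summable.tsum_sum ENNReal.summable ENNReal.summable]
  simp [Set.indicator, chain, trans]
  rfl

open Classical in
theorem chain_prob_value (V : Value) (L : ClosedTerm) :
    chain.prob (Sum.inr V) (Sum.inl L) = Pi.single (Sum.inl (V.apply L)) 1 := by
  funext s
  rcases s with P | W <;> simp [chain, trans, Pi.single_apply]

theorem LabelledMarkovChain.IsBisimulation.isSimulation {R : Setoid State}
    (hR : chain.IsBisimulation R) : IsSimulation fun M N => R (Sum.inl M) (Sum.inl N) := by
  classical
  intro M N hMN
  have value_lift : RelLift (fun V W : Value => R (Sum.inr V) (Sum.inr W)) (sem M.1) (sem N.1) := by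
    intro A
    have := hR.relLift_prob hMN (Sum.inr ()) (Sum.inr '' A)
    simpa [mass_chain_prob_term, Set.preimage_image_eq _ Sum.inr_injective] using this
  refine value_lift.mono fun V W hVW L => ?_
  have := hR.relLift_prob hVW (Sum.inl L)
  rw [chain_prob_value, chain_prob_value] at this
  exact this.rel_of_single one_ne_zero

theorem Bisimilar.similar {M N : ClosedTerm} :
    Bisimilar (Sum.inl M) (Sum.inl N) → Similar M N
  | ⟨_, hR, hMN⟩ => ⟨_, hR.1.isSimulation, hMN⟩

theorem OpenBisimilar.symm {X : Finset ℕ} {M N : TermOver X} (h : OpenBisimilar X M N) :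
    OpenBisimilar X N M := fun σ =>
  let ⟨R, hR, hMN⟩ := h σ
  ⟨R, hR, R.symm hMN⟩

/-- The extension of similarity to open terms by closing substitutions. -/
def OpenSimilar (M N : Term) : Prop :=
  ∀ σ : ℕ → ClosedTerm, Similar (M.close σ) (N.close σ)

instance : Std.Refl OpenSimilar := ⟨fun _ _ => .refl _⟩

instance : IsTrans Term OpenSimilar := ⟨fun _ _ _ h h' σ => (h σ).trans (h' σ)⟩

theorem OpenBisimilar.openSimilar {X : Finset ℕ} {M N : TermOver X} (h : OpenBisimilar X M N) :
    OpenSimilar M.1 N.1 :=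
  fun σ => (h σ).similar

theorem OpenSimilar.similar {M N : ClosedTerm} (h : OpenSimilar M.1 N.1) : Similar M N := by
  simpa only [ClosedTerm.close_eq] using h default

theorem openSimilar_body {V W : Value} (h : ∀ L, Similar (V.apply L) (W.apply L)) :
    OpenSimilar V.body W.body := by
  intro σ
  simp only [Term.close, Value.body_subst]
  exact h (σ 0)

theorem OpenSimilar.relLift_sem {M N : ClosedTerm} (h : OpenSimilar M.1 N.1) :
    RelLift (OpenSimilar on Value.body) (sem M.1) (sem N.1) :=
  (isSimulation_similar h.similar).mono fun _ _ => openSimilar_body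

/-! ## Howe's closure -/

/-- Relations on open terms that are stable under substitution. -/
def SubstClosed (R : Term → Term → Prop) : Prop :=
  ∀ ⦃M N⦄, R M N → ∀ σ : ℕ → Term, R (M.subst σ) (N.subst σ)

/-- Howe's closure of a relation `R` on open terms: the least relation that relates a term to `L`
whenever replacing its immediate subterms by related ones gives a term `R`-related to `L`. -/
inductive Howe (R : Term → Term → Prop) : Term → Term → Prop
  | var {i : ℕ} {L : Term} : R (.var i) L → Howe R (.var i) L
  | lam {P P' L : Term} : Howe R P P' → R (.lam P') L → Howe R (.lam P) L
  | app {M N M' N' L : Term} : Howe R M M' → Howe R N N' → R (.app M' N') L →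
      Howe R (.app M N) L
  | choice {M N M' N' L : Term} : Howe R M M' → Howe R N N' → R (.choice M' N') L →
      Howe R (.choice M N) L

section Howe

variable {R : Term → Term → Prop}

theorem SubstClosed.rename (hR : SubstClosed R) {M N : Term} (h : R M N) (ρ : ℕ → ℕ) :
    R (M.rename ρ) (N.rename ρ) := by
  simpa only [Term.rename_eq_subst] using hR h _

theorem SubstClosed.close_left (hR : SubstClosed R) {M : Term} {N : ClosedTerm} (h : R M N.1)
    (σ : ℕ → ClosedTerm) : R (M.close σ).1 N.1 := by
  have := hR h fun i => (σ i).1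
  rwa [Term.subst_of_FV_eq_empty N.FV_eq_empty] at this

theorem substClosed_openSimilar : SubstClosed OpenSimilar := by
  intro M N h σ τ
  simpa only [Term.close_subst] using h fun i => (σ i).close τ

namespace Howe

theorem refl [Std.Refl R] (M : Term) : Howe R M M := by
  induction M with
  | var i => exact .var (Std.Refl.refl _)
  | lam P ih => exact .lam ih (Std.Refl.refl _)
  | app M N ihM ihN => exact .app ihM ihN (Std.Refl.refl _)
  | choice M N ihM ihN => exact .choice ihM ihN (Std.Refl.refl _)

theorem trans_rel [IsTrans Term R] {M N L : Term} (h : Howe R M N) (h' : R N L) :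
    Howe R M L := by
  cases h with
  | var h => exact .var (_root_.trans h h')
  | lam hP h => exact .lam hP (_root_.trans h h')
  | app hM hN h => exact .app hM hN (_root_.trans h h')
  | choice hM hN h => exact .choice hM hN (_root_.trans h h')

theorem of_rel [Std.Refl R] [IsTrans Term R] {M N : Term} (h : R M N) : Howe R M N :=
  (refl M).trans_rel h

theorem rename {M N : Term} (h : Howe R M N) (hR : SubstClosed R) (ρ : ℕ → ℕ) :
    Howe R (M.rename ρ) (N.rename ρ) := by
  induction h generalizing ρ with
  | var h => exact .var (hR.rename h ρ)
  | lam _ h ih => exact .lam (ih _) (hR.rename h ρ)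
  | app _ _ h ihM ihN => exact .app (ihM ρ) (ihN ρ) (hR.rename h ρ)
  | choice _ _ h ihM ihN => exact .choice (ihM ρ) (ihN ρ) (hR.rename h ρ)

theorem fill [Std.Refl R] {M N : Term} (h : Howe R M N) (hR : SubstClosed R) (C : Ctx) :
    Howe R (C.fill M) (C.fill N) := by
  induction C with
  | hole => exact h
  | lam x C ih => exact .lam (ih.rename hR _) (Std.Refl.refl _)
  | appL C L ih => exact .app ih (.refl L) (Std.Refl.refl _)
  | appR L C ih => exact .app (.refl L) ih (Std.Refl.refl _)
  | choiceL C L ih => exact .choice ih (.refl L) (Std.Refl.refl _)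
  | choiceR L C ih => exact .choice (.refl L) ih (Std.Refl.refl _)

variable [Std.Refl R] [IsTrans Term R]

theorem subst {M N : Term} (h : Howe R M N) (hR : SubstClosed R) {σ τ : ℕ → Term}
    (hστ : ∀ i, Howe R (σ i) (τ i)) : Howe R (M.subst σ) (N.subst τ) := by
  induction h generalizing σ τ with
  | var h => exact (hστ _).trans_rel (hR h _)
  | lam _ h ih =>
    refine .lam (ih fun i => ?_) (hR h _)
    cases i with
    | zero => exact .refl _
    | succ i => exact (hστ i).rename hR _
  | app _ _ h ihM ihN => exact .app (ihM hστ) (ihN hστ) (hR h _)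
  | choice _ _ h ihM ihN => exact .choice (ihM hστ) (ihN hστ) (hR h _)

theorem inst {P Q M N : Term} (h : Howe R P Q) (hR : SubstClosed R) (h' : Howe R M N) :
    Howe R (P.inst M) (Q.inst N) :=
  h.subst hR fun i => by
    cases i with
    | zero => exact h'
    | succ i => exact .refl _

theorem close_right {M N : Term} (h : Howe R M N) (hR : SubstClosed R) (hM : M.FV = ∅)
    (σ : ℕ → ClosedTerm) : Howe R M (N.close σ).1 := by
  have := h.subst hR fun i => refl (σ i).1
  rwa [Term.subst_of_FV_eq_empty hM] at this

-- The closure relates closed terms through open ones, which are replaced by closed instances.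
theorem exists_of_toTerm {V : Value} {L : ClosedTerm} (h : Howe R V.toTerm L.1)
    (hR : SubstClosed R) : ∃ W : Value, Howe R V.body W.body ∧ R W.toTerm L.1 := by
  obtain ⟨P, hVP, hPL⟩ : ∃ P, Howe R V.body P ∧ R (.lam P) L.1 := by
    cases h with
    | lam hP hPL => exact ⟨_, hP, hPL⟩
  let σ : ℕ → ClosedTerm := default
  let W : Value := ⟨P.subst (Term.liftSub fun i => (σ i).1), ((Term.lam P).close σ).FV_eq_empty⟩
  have body_subst : V.body.subst (Term.liftSub fun i => (σ i).1) = V.body :=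
    Term.lam.inj (Term.subst_of_FV_eq_empty V.closed _)
  have hVW : Howe R V.body W.body := body_subst ▸ hVP.subst hR fun _ => refl _
  exact ⟨W, hVW, hR.close_left hPL σ⟩

theorem exists_of_app {M N : Term} {L : ClosedTerm} (h : Howe R (.app M N) L.1)
    (hR : SubstClosed R) (hM : M.FV = ∅) (hN : N.FV = ∅) :
    ∃ M' N' : ClosedTerm, Howe R M M'.1 ∧ Howe R N N'.1 ∧ R (.app M'.1 N'.1) L.1 := by
  cases h with
  | app hMM' hNN' hL =>
    exact ⟨_, _, hMM'.close_right hR hM default, hNN'.close_right hR hN default,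
      hR.close_left hL default⟩

theorem exists_of_choice {M N : Term} {L : ClosedTerm} (h : Howe R (.choice M N) L.1)
    (hR : SubstClosed R) (hM : M.FV = ∅) (hN : N.FV = ∅) :
    ∃ M' N' : ClosedTerm, Howe R M M'.1 ∧ Howe R N N'.1 ∧ R (.choice M'.1 N'.1) L.1 := by
  cases h with
  | choice hMM' hNN' hL =>
    exact ⟨_, _, hMM'.close_right hR hM default, hNN'.close_right hR hN default,
      hR.close_left hL default⟩

end Howe

end Howe

/-! ## Soundness of similarity -/

theorem RelLift.trans_openSimilar {D : Value → ℝ≥0∞} {M : Term} {N : ClosedTerm}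
    (h : RelLift (Howe OpenSimilar on Value.body) D (sem M)) (hM : M.FV = ∅)
    (hMN : OpenSimilar M N.1) : RelLift (Howe OpenSimilar on Value.body) D (sem N.1) := by
  have hMN' := OpenSimilar.relLift_sem (M := ⟨M, by simp [hM]⟩) hMN
  exact (h.comp hMN').mono fun V U ⟨W, hVW, hWU⟩ => hVW.trans_rel hWU

theorem BigStep.relLift_of_howe {M : Term} {D : Value → ℝ≥0∞} (hD : BigStep M D)
    {N : ClosedTerm} (hM : M.FV = ∅) (hMN : Howe OpenSimilar M N.1) :
    RelLift (Howe OpenSimilar on Value.body) D (sem N.1) := by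
  induction hD generalizing N with
  | bt => exact .zero _ _
  | bv V =>
    obtain ⟨W, hVW, hWN⟩ := hMN.exists_of_toTerm substClosed_openSimilar
    classical
    have hsingle := RelLift.single (R := Howe OpenSimilar on Value.body) hVW (one_le_sem_toTerm W)
    exact hsingle.trans_openSimilar W.closed hWN
  | @ba M L D E _ _ ihD ihE =>
    obtain ⟨hM, hL⟩ := Set.union_empty_iff.1 hM
    obtain ⟨M', L', hMM', hLL', hN⟩ := hMN.exists_of_app substClosed_openSimilar hM hL
    have hE : ∀ V W : Value, D V ≠ 0 → Howe OpenSimilar V.body W.body →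
        RelLift (Howe OpenSimilar on Value.body) (E V) (sem (W.body.inst L'.1)) :=
      fun V W hDV hVW => ihE V hDV (N := W.apply L') (V.apply ⟨L, by simp [hL]⟩).FV_eq_empty
        (hVW.inst substClosed_openSimilar hLL')
    exact ((ihD hM hMM').bind hE).mono_right (tsum_sem_mul_sem_inst_le_sem_app _ _)
      |>.trans_openSimilar (by simp [Term.FV, ClosedTerm.FV_eq_empty]) hN
  | bs _ _ ihD ihE =>
    obtain ⟨hM, hL⟩ := Set.union_empty_iff.1 hM
    obtain ⟨M', L', hMM', hLL', hN⟩ := hMN.exists_of_choice substClosed_openSimilar hM hL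
    exact (((ihD hM hMM').smul 2⁻¹).add ((ihE hL hLL').smul 2⁻¹)).mono_right
        (average_sem_le_sem_choice _ _)
      |>.trans_openSimilar (by simp [Term.FV, ClosedTerm.FV_eq_empty]) hN

theorem Howe.tsum_sem_le {M N : ClosedTerm} (h : Howe OpenSimilar M.1 N.1) :
    ∑' V, sem M.1 V ≤ ∑' V, sem N.1 V :=
  (relLift_sem_left fun _ hD => hD.relLift_of_howe M.FV_eq_empty h).tsum_le

theorem OpenSimilar.ctxPreorder {X : Finset ℕ} {M N : TermOver X} (h : OpenSimilar M.1 N.1) :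
    CtxPreorder X M N := by
  rintro C hC p rfl
  have hCMN : Howe OpenSimilar (C.fill M.1) (C.fill N.1) :=
    (Howe.of_rel h).fill substClosed_openSimilar C
  exact ⟨_, rfl, Howe.tsum_sem_le (M := ⟨C.fill M.1, hC.FV_fill_subset M.2⟩)
    (N := ⟨C.fill N.1, hC.FV_fill_subset N.2⟩) hCMN⟩

end LambdaOplus

theorem mainTheorem2 (X : Finset ℕ) (M N : LambdaOplus.TermOver X)
    (h : LambdaOplus.OpenBisimilar X M N) : LambdaOplus.CtxEquiv X M N :=
  ⟨h.openSimilar.ctxPreorder, h.symm.openSimilar.ctxPreorder⟩
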